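/- Composition is written in diagrammatic order. Let $\mathbb X$ be a Cartesian restriction category: a category in which every map $f:X\to Y$ has a restriction $\overline f:X\to X$ satisfying $\overline f f=f$, $\overline f\,\overline g=\overline g\,\overline f$, $\overline{\overline f g}=\overline f\,\overline g$ and $f\overline g=\overline{fg}f$, with a chosen restriction terminal object $1$ (total maps $!_X:X\to 1$ with $f=\overline f\,!_X$ for every $f:X\to 1$) and chosen restriction products $A\times B$ (total projections such that any $f:Z\to A$, $g:Z\to B$ have a unique pairing $\langle f,g\rangle$ with $\langle f,g\rangle\pi_0\le f$, $\langle f,g\rangle\pi_1\le g$ and $\overline{\langle f,g\rangle}=\overline f\,\overline g$). In any restriction category, $f$ is total if $\overline f=1$; for parallel maps, $f\le g$ means $\overline f g=f$ and $f\smile g$ means $\overline f g=\overline g f$. The Faà di Bruno category $\mathrm{Fa\grave a}(\mathbb X)$ is the following restriction category. An object is a pair $(A,X)$ of a commutative monoid $(A,+,0)$ in $\mathbb X$ with total structure maps and an object $X$ of $\mathbb X$. A map $f:(A,X)\to(B,Y)$ is a sequence $(f_*,f_1,f_2,\dots)$ with $f_*:X\to Y$ and $f_n:A^n\times X\to B$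 for $n\ge 1$, where $f_n$ is additive and symmetric in its first $n$ variables and $\overline{f_n}=\overline{\pi_n f_*}$ ($\pi_n:A^n\times X\to X$ being the last projection). Additive means that in each of these variables $f_n$ preserves $u+v=\langle u,v\rangle +$, and that substituting $0$ for the variable gives a restriction of the zero map $0=\,!\,0_B$. The identity is $(1,\pi_0,0,0,\dots)$. Composition is $(fg)_*=f_*g_*$ and $$(fg)_n=\sum_{\{B_1,\dots,B_k\}}\big\langle p_{B_1}f_{|B_1|},\dots,p_{B_k}f_{|B_k|},\pi_n f_*\big\rangle g_k ,$$ the sum being over all partitions of $\{0,\dots,n-1\}$ into nonempty blocks, with $p_B=\langle \pi_{j_1},\dots,\pi_{j_m},\pi_n\rangle$ for $B=\{j_1,\dots,j_m\}$. The restriction of $f$ is $$\overline{f}=(\overline{f_*},\ \overline{\pi_1f_*}\,\pi_0,\ \overline{\pi_2 f_*}\,0,\ \overline{\pi_3 f_*}\,0,\dots).$$ **Proposition.** For maps $f,g:(A,X)\to(B,Y)$ in $\mathrm{Fa\grave a}(\mathbb X)$: (i) $f$ is total if and only if $f_*$ is total; (ii) $f\le g$ if and only if $f_*\le g_*$ and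 $f_n\le g_n$ for each $n\ge1$; (iii) $f\smile g$ if and only if $f_*\smile g_*$ and $f_n\smile g_n$ for each $n\ge 1$. -/

import Mathlib

open CategoryTheory

universe v u

/-- A restriction category: every map `f : X ⟶ Y` has a restriction `rst f : X ⟶ X`
(often written
`f̄`) subject to four axioms.  Composition is in diagrammatic order. -/
class RestrictionCategory (C : Type u) [Category.{v} C] where
  rst : ∀ {X Y : C}, (X ⟶ Y) → (X ⟶ X)
  rst_comp_self : ∀ {X Y : C} (f : X ⟶ Y), rst f ≫ f = f
  rst_comm : ∀ {X Y Z : C} (f : X ⟶ Y) (g : X ⟶ Z), rst f ≫ rst g = rst g ≫ rst f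
  rst_rst_comp : ∀ {X Y Z : C} (f : X ⟶ Y) (g : X ⟶ Z), rst (rst f ≫ g) = rst f ≫ rst g
  comp_rst : ∀ {X Y Z : C} (f : X ⟶ Y) (g : Y ⟶ Z), f ≫ rst g = rst (f ≫ g) ≫ f

namespace RestrictionCategory

variable {C : Type u} [Category.{v} C] [RestrictionCategory C]

/-- A map is total if its restriction is the identity. -/
def IsTotal {X Y : C} (f : X ⟶ Y) : Prop := rst f = 𝟙 X

/-- The restriction order on parallel maps, `f ≤ g`. -/
def RLe {X Y : C} (f g : X ⟶ Y) : Prop := rst f ≫ g = f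

/-- Compatibility of parallel maps, `f ⌣ g`. -/
def Compat {X Y : C} (f g : X ⟶ Y) : Prop := rst f ≫ g = rst g ≫ f

end RestrictionCategory

open RestrictionCategory

/-- A Cartesian restriction category: a restriction category with a chosen restriction terminal
object and chosen binary restriction products. -/
class CartesianRestrictionCategory (C : Type u) [Category.{v} C] extends
    RestrictionCategory C where
  one : C
  bang : ∀ X : C, X ⟶ one
  bang_total : ∀ X : C, IsTotal (bang X)
  bang_unique : ∀ {X : C} (f : X ⟶ one), RLe f (bang X)
  prod : C → C → C
  fst : ∀ A B : C, prod A B ⟶ A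
  snd : ∀ A B : C, prod A B ⟶ B
  fst_total : ∀ A B : C, IsTotal (fst A B)
  snd_total : ∀ A B : C, IsTotal (snd A B)
  pair : ∀ {Z A B : C}, (Z ⟶ A) → (Z ⟶ B) → (Z ⟶ prod A B)
  pair_fst : ∀ {Z A B : C} (f : Z ⟶ A) (g : Z ⟶ B), RLe (pair f g ≫ fst A B) f
  pair_snd : ∀ {Z A B : C} (f : Z ⟶ A) (g : Z ⟶ B), RLe (pair f g ≫ snd A B) g
  rst_pair : ∀ {Z A B : C} (f : Z ⟶ A) (g : Z ⟶ B), rst (pair f g) = rst f ≫ rst g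
  pair_unique : ∀ {Z A B : C} (f : Z ⟶ A) (g : Z ⟶ B) (h : Z ⟶ prod A B),
    RLe (h ≫ fst A B) f → RLe (h ≫ snd A B) g → rst h = rst f ≫ rst g → h = pair f g

section

open CartesianRestrictionCategory

/-- A total commutative monoid `(A, +, 0)` in a Cartesian restriction category. -/
structure TotalCommMonoid (C : Type u) [Category.{v} C] [CartesianRestrictionCategory C] where
  carrier : C
  add : prod carrier carrier ⟶ carrier
  zero : one (C := C) ⟶ carrier
  add_total : IsTotal add
  zero_total : IsTotal zero
  add_assoc :
    pair (fst (prod carrier carrier) carrier ≫ add) (snd (prod carrier carrier) carrier) ≫ add =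
      pair (fst (prod carrier carrier) carrier ≫ fst carrier carrier)
        (pair (fst (prod carrier carrier) carrier ≫ snd carrier carrier)
          (snd (prod carrier carrier) carrier) ≫ add) ≫ add
  add_comm : pair (snd carrier carrier) (fst carrier carrier) ≫ add = add
  zero_add : pair (bang carrier ≫ zero) (𝟙 carrier) ≫ add = 𝟙 carrier

namespace RestrictionCategory

variable {C : Type u} [Category.{v} C] [RestrictionCategory C]

theorem rst_id (X : C) : rst (𝟙 X) = 𝟙 X := by
  simpa using rst_comp_self (𝟙 X)

theorem rst_rst {X Y : C} (f : X ⟶ Y) : rst (rst f) = rst f := by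
  simpa [rst_id] using rst_rst_comp f (𝟙 X)

theorem rst_idem {X Y : C} (f : X ⟶ Y) : rst f ≫ rst f = rst f := by
  rw [← rst_rst_comp, rst_comp_self]

theorem rst_comp_rst {X Y Z : C} (f : X ⟶ Y) (g : Y ⟶ Z) : rst (f ≫ rst g) = rst (f ≫ g) := by
  rw [comp_rst, rst_rst_comp, rst_comm, ← rst_rst_comp, ← Category.assoc, rst_comp_self]

theorem rst_comp_total {X Y Z : C} (f : X ⟶ Y) (g : Y ⟶ Z) (hg : IsTotal g) :
    rst (f ≫ g) = rst f := by
  rw [← rst_comp_rst, hg, Category.comp_id]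

/-- The restriction idempotents on an object, a meet-semilattice under composition. -/
@[ext]
structure Dom (Z : C) : Type v where
  val : Z ⟶ Z
  property : rst val = val

instance (Z : C) : SemilatticeInf (Dom Z) where
  le d e := d.1 ≫ e.1 = d.1
  le_refl d := by have := rst_idem d.1; rwa [d.2] at this
  le_trans a b c h h' := by
    change _ ≫ _ = _ at h h' ⊢
    rw [← h, Category.assoc, h']
  le_antisymm a b h h' := by
    change _ ≫ _ = _ at h h'
    have h2 := rst_comm a.1 b.1
    rw [a.2, b.2, h, h'] at h2
    exact Dom.ext h2
  inf a b := ⟨a.1 ≫ b.1, by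
    have := rst_rst_comp a.1 b.1
    rwa [a.2, b.2] at this⟩
  inf_le_left a b := by
    change (_ ≫ _) ≫ _ = _ ≫ _
    have h := rst_idem a.1
    have h' := rst_comm a.1 b.1
    rw [a.2] at h
    rw [a.2, b.2] at h'
    rw [h', Category.assoc, h]
  inf_le_right a b := by
    change (_ ≫ _) ≫ _ = _ ≫ _
    have h := rst_idem b.1
    rw [b.2] at h
    rw [Category.assoc, h]
  le_inf a b c h h' := by
    change _ ≫ _ = _ at h h'
    change _ ≫ _ ≫ _ = _
    rw [← Category.assoc, h, h']

instance (Z : C) : OrderTop (Dom Z) where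
  top := ⟨𝟙 Z, rst_id Z⟩
  le_top _ := Category.comp_id _

/-- The domain of definition of a map. -/
def dom {Z Y : C} (f : Z ⟶ Y) : Dom Z := ⟨rst f, rst_rst f⟩

theorem dom_restr {Z Y : C} (d : Dom Z) (f : Z ⟶ Y) : dom (d.1 ≫ f) = d ⊓ dom f := by
  apply Dom.ext
  have := rst_rst_comp d.1 f
  rwa [d.2] at this

theorem restr_eq_iff {Z Y : C} (d : Dom Z) (f : Z ⟶ Y) : d.1 ≫ f = f ↔ dom f ≤ d := by
  constructor
  · intro h
    rw [← h, dom_restr]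
    exact inf_le_left
  · intro h
    change rst f ≫ d.1 = rst f at h
    have h2 := rst_comm f d.1
    rw [d.2] at h2
    rw [h2] at h
    conv_lhs => rw [← rst_comp_self f, ← Category.assoc, h, rst_comp_self]

theorem dom_comp_le {X Y Z : C} (f : X ⟶ Y) (g : Y ⟶ Z) : dom (f ≫ g) ≤ dom f := by
  rw [← restr_eq_iff]
  change rst f ≫ f ≫ g = _
  rw [← Category.assoc, rst_comp_self]

theorem dom_comp_total {X Y Z : C} (f : X ⟶ Y) (g : Y ⟶ Z) (hg : IsTotal g) :
    dom (f ≫ g) = dom f := Dom.ext (rst_comp_total f g hg)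

theorem isTotal_iff {Z Y : C} (f : Z ⟶ Y) : IsTotal f ↔ dom f = ⊤ := by
  rw [Dom.ext_iff]
  rfl

theorem restr_comp {Z Y : C} (d e : Dom Z) (f : Z ⟶ Y) : d.1 ≫ e.1 ≫ f = (d ⊓ e).1 ≫ f := by
  rw [← Category.assoc]
  rfl

/-- Pulling back a restriction idempotent along a map. -/
theorem comp_restr {X Y Z : C} (f : X ⟶ Y) (d : Dom Y) (g : Y ⟶ Z) :
    f ≫ d.1 ≫ g = (dom (f ≫ d.1)).1 ≫ f ≫ g := by
  rw [← Category.assoc, ← Category.assoc]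
  congr 1
  have := comp_rst f d.1
  rwa [d.2] at this

end RestrictionCategory

namespace CartesianRestrictionCategory

variable {C : Type u} [Category.{v} C] [CartesianRestrictionCategory C]

theorem dom_pair {Z A B : C} (f : Z ⟶ A) (g : Z ⟶ B) : dom (pair f g) = dom f ⊓ dom g :=
  Dom.ext (rst_pair f g)

theorem pair_fst_eq {Z A B : C} (f : Z ⟶ A) (g : Z ⟶ B) :
    pair f g ≫ fst A B = (dom g).1 ≫ f := by
  have h := pair_fst f g
  rw [RLe, rst_comp_total _ _ (fst_total A B), rst_pair, rst_comm, Category.assoc,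
    rst_comp_self] at h
  exact h.symm

theorem pair_snd_eq {Z A B : C} (f : Z ⟶ A) (g : Z ⟶ B) :
    pair f g ≫ snd A B = (dom f).1 ≫ g := by
  have h := pair_snd f g
  rw [RLe, rst_comp_total _ _ (snd_total A B), rst_pair, Category.assoc,
    rst_comp_self] at h
  exact h.symm

theorem pair_eta {Z A B : C} (h : Z ⟶ prod A B) : pair (h ≫ fst A B) (h ≫ snd A B) = h := by
  symm
  apply pair_unique
  · exact rst_comp_self _
  · exact rst_comp_self _
  · rw [rst_comp_total _ _ (fst_total A B), rst_comp_total _ _ (snd_total A B), rst_idem]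

theorem prod_ext {Z A B : C} {h k : Z ⟶ prod A B} (h1 : h ≫ fst A B = k ≫ fst A B)
    (h2 : h ≫ snd A B = k ≫ snd A B) : h = k := by
  rw [← pair_eta h, h1, h2, pair_eta]

theorem comp_pair {W Z A B : C} (h : W ⟶ Z) (f : Z ⟶ A) (g : Z ⟶ B) :
    h ≫ pair f g = pair (h ≫ f) (h ≫ g) := by
  apply prod_ext
  · rw [Category.assoc, pair_fst_eq, pair_fst_eq, comp_restr]
    congr 2
    exact Dom.ext (rst_comp_rst h g)
  · rw [Category.assoc, pair_snd_eq, pair_snd_eq, comp_restr]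
    congr 2
    exact Dom.ext (rst_comp_rst h f)

theorem pair_restr_right {Z A B : C} (d : Dom Z) (f : Z ⟶ A) (g : Z ⟶ B) :
    pair f (d.1 ≫ g) = d.1 ≫ pair f g := by
  apply prod_ext
  · rw [Category.assoc, pair_fst_eq, pair_fst_eq, dom_restr, restr_comp]
  · rw [Category.assoc, pair_snd_eq, pair_snd_eq, restr_comp, restr_comp, inf_comm]

theorem pair_restr_left {Z A B : C} (d : Dom Z) (f : Z ⟶ A) (g : Z ⟶ B) :
    pair (d.1 ≫ f) g = d.1 ≫ pair f g := by
  apply prod_ext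
  · rw [Category.assoc, pair_fst_eq, pair_fst_eq, restr_comp, restr_comp, inf_comm]
  · rw [Category.assoc, pair_snd_eq, pair_snd_eq, dom_restr, restr_comp]

theorem comp_bang {X Y : C} (h : X ⟶ Y) : h ≫ bang Y = (dom h).1 ≫ bang X := by
  have := bang_unique (h ≫ bang Y)
  rw [RLe, rst_comp_total _ _ (bang_total Y)] at this
  exact this.symm

end CartesianRestrictionCategory

namespace TotalCommMonoid

variable {C : Type u} [Category.{v} C] [CartesianRestrictionCategory C]

/-- Maps into a commutative monoid: `f + g = ⟨f, g⟩ +` and `0 = ! 0`. -/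
instance instAddHom (A : TotalCommMonoid C) (Z : C) : Add (Z ⟶ A.carrier) :=
  ⟨fun f g => pair f g ≫ A.add⟩

instance instZeroHom (A : TotalCommMonoid C) (Z : C) : Zero (Z ⟶ A.carrier) :=
  ⟨bang Z ≫ A.zero⟩

variable {A : TotalCommMonoid C} {W Z : C}

theorem hom_add_def (f g : Z ⟶ A.carrier) : f + g = pair f g ≫ A.add := rfl

theorem hom_zero_def : (0 : Z ⟶ A.carrier) = bang Z ≫ A.zero := rfl

theorem comp_add (h : W ⟶ Z) (f g : Z ⟶ A.carrier) : h ≫ (f + g) = h ≫ f + h ≫ g := by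
  rw [hom_add_def, hom_add_def, ← Category.assoc, comp_pair]

theorem comp_zero (h : W ⟶ Z) : h ≫ (0 : Z ⟶ A.carrier) = (dom h).1 ≫ (0 : W ⟶ A.carrier) := by
  rw [hom_zero_def, hom_zero_def, ← Category.assoc, comp_bang, Category.assoc]

theorem dom_add (f g : Z ⟶ A.carrier) : dom (f + g) = dom f ⊓ dom g := by
  rw [hom_add_def, dom_comp_total _ _ A.add_total, dom_pair]

theorem dom_zero : dom (0 : Z ⟶ A.carrier) = ⊤ := by
  rw [hom_zero_def, dom_comp_total _ _ A.zero_total, ← isTotal_iff]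
  exact bang_total Z

theorem restr_add (d : Dom Z) (f g : Z ⟶ A.carrier) : (d.1 ≫ f) + g = d.1 ≫ (f + g) := by
  rw [hom_add_def, hom_add_def, pair_restr_left, Category.assoc]

theorem hom_add_comm (f g : Z ⟶ A.carrier) : f + g = g + f := by
  rw [hom_add_def, hom_add_def]
  conv_lhs => rw [← A.add_comm]
  rw [← Category.assoc, comp_pair, pair_fst_eq, pair_snd_eq, pair_restr_left, pair_restr_right,
    restr_comp]
  congr 1
  rw [restr_eq_iff, dom_pair, inf_comm]

theorem hom_zero_add (f : Z ⟶ A.carrier) : 0 + f = f := by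
  have h := congrArg (f ≫ ·) A.zero_add
  rw [← Category.assoc, comp_pair, ← Category.assoc, comp_bang, Category.comp_id,
    Category.assoc, pair_restr_left, Category.assoc] at h
  rw [hom_add_def, hom_zero_def]
  refine Eq.trans ?_ h
  symm
  rw [restr_eq_iff, dom_comp_total _ _ A.add_total, dom_pair]
  exact inf_le_right

theorem hom_add_assoc (f g k : Z ⟶ A.carrier) : f + g + k = f + (g + k) := by
  have h := congrArg (pair (pair f g) k ≫ ·) A.add_assoc
  simp only [← Category.assoc, comp_pair, pair_fst_eq, pair_snd_eq] at h
  simp only [Category.assoc, pair_restr_left, pair_restr_right,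
    dom_pair, dom_restr, restr_comp] at h
  simp only [hom_add_def]
  rw [(restr_eq_iff _ _).2, (restr_eq_iff _ _).2] at h
  · exact h
  all_goals
    simp only [dom_comp_total _ _ A.add_total, dom_pair, le_inf_iff]
    simp [inf_le_of_left_le, inf_le_of_right_le]

instance instAddCommMonoidHom (A : TotalCommMonoid C) (Z : C) :
    AddCommMonoid (Z ⟶ A.carrier) where
  add_assoc := hom_add_assoc
  zero_add := hom_zero_add
  add_zero f := by rw [hom_add_comm, hom_zero_add]
  add_comm := hom_add_comm
  nsmul := nsmulRec

end TotalCommMonoid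

namespace CartesianRestrictionCategory

variable {C : Type u} [Category.{v} C] [CartesianRestrictionCategory C]

/-- The object `A × A × ⋯ × A × X` with `n` copies of `A`. -/
@[reducible]
def powProd (A X : C) : ℕ → C
  | 0 => X
  | n + 1 => prod A (powProd A X n)

/-- The projection of `A × ⋯ × A × X` to the `i`-th copy of `A` (counted from `0`). -/
def powProj (A X : C) : (n : ℕ) → Fin n → (powProd A X n ⟶ A)
  | 0 => Fin.elim0
  | n + 1 => Fin.cases (fst A (powProd A X n))
      (fun i => snd A (powProd A X n) ≫ powProj A X n i)

/-- The projection of `A × ⋯ × A × X` to `X`, that is, the projection `π_n`. -/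
def powLast (A X : C) : (n : ℕ) → (powProd A X n ⟶ X)
  | 0 => 𝟙 X
  | n + 1 => snd A (powProd A X n) ≫ powLast A X n

/-- The tuple `⟨a 0, …, a (n - 1), x⟩ : Z ⟶ A × ⋯ × A × X`. -/
def tuple {A X Z : C} : {n : ℕ} → (Fin n → (Z ⟶ A)) → (Z ⟶ X) → (Z ⟶ powProd A X n)
  | 0, _, x => x
  | _ + 1, a, x => pair (a 0) (tuple (fun i => a i.succ) x)

variable {A X Z W : C}

theorem comp_tuple (h : W ⟶ Z) {n : ℕ} (a : Fin n → (Z ⟶ A)) (x : Z ⟶ X) :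
    h ≫ tuple a x = tuple (fun i => h ≫ a i) (h ≫ x) := by
  induction n with
  | zero => rfl
  | succ n ih => simp only [tuple, comp_pair, ih]

theorem le_dom_tuple {n : ℕ} (d : Dom Z) (a : Fin n → (Z ⟶ A)) (x : Z ⟶ X) :
    d ≤ dom (tuple a x) ↔ (∀ i, d ≤ dom (a i)) ∧ d ≤ dom x := by
  induction n with
  | zero => simp [tuple]
  | succ n ih => rw [tuple, dom_pair, le_inf_iff, ih, Fin.forall_fin_succ, and_assoc]

theorem powProj_total : ∀ (n : ℕ) (i : Fin n), IsTotal (powProj A X n i)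
  | n + 1, i => by
    refine Fin.cases (fst_total _ _) (fun i => ?_) i
    have := powProj_total n i
    rw [isTotal_iff] at this ⊢
    simp only [powProj, Fin.cases_succ]
    rw [dom_comp_total _ _ (powProj_total n i), ← isTotal_iff]
    exact snd_total _ _

theorem powLast_total : ∀ n : ℕ, IsTotal (powLast A X n)
  | 0 => rst_id X
  | n + 1 => by
    rw [isTotal_iff]
    simp only [powLast]
    rw [dom_comp_total _ _ (powLast_total n), ← isTotal_iff]
    exact snd_total _ _

theorem tuple_proj {n : ℕ} (a : Fin n → (Z ⟶ A)) (x : Z ⟶ X) (i : Fin n) :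
    tuple a x ≫ powProj A X n i = (dom (tuple a x)).1 ≫ a i := by
  induction n with
  | zero => exact i.elim0
  | succ n ih =>
    refine Fin.cases ?_ (fun i => ?_) i
    · simp only [powProj, tuple, Fin.cases_zero]
      rw [pair_fst_eq, dom_pair, inf_comm, ← restr_comp, (restr_eq_iff _ (a 0)).2 le_rfl]
    · simp only [powProj, tuple, Fin.cases_succ]
      rw [← Category.assoc, pair_snd_eq, Category.assoc, ih, restr_comp, dom_pair]

theorem tuple_last {n : ℕ} (a : Fin n → (Z ⟶ A)) (x : Z ⟶ X) :
    tuple a x ≫ powLast A X n = (dom (tuple a x)).1 ≫ x := by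
  induction n with
  | zero => exact (Category.comp_id _).trans (rst_comp_self x).symm
  | succ n ih =>
    simp only [powLast, tuple]
    rw [← Category.assoc, pair_snd_eq, Category.assoc, ih, restr_comp, dom_pair]

theorem tuple_eta (A X : C) (n : ℕ) :
    tuple (powProj A X n) (powLast A X n) = 𝟙 (powProd A X n) := by
  induction n with
  | zero => rfl
  | succ n ih =>
    simp only [tuple, powProj, powLast, Fin.cases_zero, Fin.cases_succ]
    rw [← comp_tuple, ih]
    have := pair_eta (𝟙 (prod A (powProd A X n)))
    simpa using this

end CartesianRestrictionCategory

namespace Faa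

variable {C : Type u} [Category.{v} C] [CartesianRestrictionCategory C]

/-- A map `A × ⋯ × A × X ⟶ B` is additive in its first `n` variables, where `A` and `B` carry
commutative monoid structures: in each of these variables it preserves sums, and preserves `0`
up to restriction.  Variables are generalized elements. -/
def IsAdditive {A B : TotalCommMonoid C} {X : C} {n : ℕ}
    (f : powProd A.carrier X n ⟶ B.carrier) : Prop :=
  ∀ (Z : C) (a : Fin n → (Z ⟶ A.carrier)) (x : Z ⟶ X) (i : Fin n),
    (∀ u v : Z ⟶ A.carrier, tuple (Function.update a i (u + v)) x ≫ f =
      tuple (Function.update a i u) x ≫ f + tuple (Function.update a i v) x ≫ f) ∧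
    tuple (Function.update a i 0) x ≫ f = rst (tuple (Function.update a i 0) x ≫ f) ≫ 0

/-- A map `A × ⋯ × A × X ⟶ B` is symmetric in its first `n` variables. -/
def IsSymmetric {A B X : C} {n : ℕ} (f : powProd A X n ⟶ B) : Prop :=
  ∀ (Z : C) (a : Fin n → (Z ⟶ A)) (x : Z ⟶ X) (σ : Equiv.Perm (Fin n)),
    tuple (fun i => a (σ i)) x ≫ f = tuple a x ≫ f

end Faa

/-- The objects of the Faà di Bruno category: pairs of a total commutative monoid and an object. -/
structure Faa (C : Type u) [Category.{v} C] [CartesianRestrictionCategory C] where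
  mon : TotalCommMonoid C
  pt : C

namespace Faa

variable {C : Type u} [Category.{v} C] [CartesianRestrictionCategory C]

/-- The maps of the Faà di Bruno category: sequences `(f_*, f_1, f_2, …)`, where `base` is `f_*`
and `app n` is `f_n`, for `n ≥ 1`. -/
@[ext]
structure Hom (X Y : Faa C) where
  base : X.pt ⟶ Y.pt
  app : ∀ n : ℕ, 0 < n → (powProd X.mon.carrier X.pt n ⟶ Y.mon.carrier)
  rst_app : ∀ (n : ℕ) (hn : 0 < n),
    rst (app n hn) = rst (powLast X.mon.carrier X.pt n ≫ base)
  additive : ∀ (n : ℕ) (hn : 0 < n), IsAdditive (A := X.mon) (B := Y.mon) (app n hn)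
  symmetric : ∀ (n : ℕ) (hn : 0 < n), IsSymmetric (app n hn)

/-- The value `⟨a, x⟩ f_n` of the `n`-th component of `f` on a family `a` of `n` elements,
indexed by a nonempty finite type `ι` with `n` elements.  As `f_n` is symmetric, the chosen
enumeration of `ι` does not matter. -/
noncomputable def Hom.ev {X Y : Faa C} (f : Hom X Y) {ι : Type} [Finite ι] [Nonempty ι] {Z : C}
    (a : ι → (Z ⟶ X.mon.carrier)) (x : Z ⟶ X.pt) : Z ⟶ Y.mon.carrier :=
  tuple (fun k => a ((Finite.equivFin ι).symm k)) x ≫ f.app (Nat.card ι) Nat.card_pos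

section ev

variable {X Y V : Faa C} {Z W : C} {ι ι' : Type} [Finite ι] [Nonempty ι] [Finite ι'] [Nonempty ι']

theorem ev_eq_tuple (f : Hom X Y) (a : ι → (Z ⟶ X.mon.carrier)) (x : Z ⟶ X.pt) {n : ℕ}
    (hn : 0 < n) (e : Fin n ≃ ι) : f.ev a x = tuple (fun k => a (e k)) x ≫ f.app n hn := by
  obtain rfl : n = Nat.card ι := by rw [← Nat.card_congr e, Nat.card_fin]
  have := f.symmetric (Nat.card ι) hn Z (fun k => a (e k)) x
    ((Finite.equivFin ι).symm.trans e.symm)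
  simpa [Hom.ev] using this

theorem ev_congr (f : Hom X Y) {a : ι → (Z ⟶ X.mon.carrier)} {a' : ι' → (Z ⟶ X.mon.carrier)}
    (x : Z ⟶ X.pt) (e : ι ≃ ι') (h : ∀ i, a i = a' (e i)) : f.ev a x = f.ev a' x := by
  rw [ev_eq_tuple f a x Nat.card_pos (Finite.equivFin ι).symm,
    ev_eq_tuple f a' x Nat.card_pos ((Finite.equivFin ι).symm.trans e)]
  simp [h]

theorem comp_ev (f : Hom X Y) (h : W ⟶ Z) (a : ι → (Z ⟶ X.mon.carrier)) (x : Z ⟶ X.pt) :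
    h ≫ f.ev a x = f.ev (fun i => h ≫ a i) (h ≫ x) := by
  rw [Hom.ev, ← Category.assoc, comp_tuple, Hom.ev]

theorem le_dom_ev (f : Hom X Y) (a : ι → (Z ⟶ X.mon.carrier)) (x : Z ⟶ X.pt) (d : Dom Z) :
    d ≤ dom (f.ev a x) ↔ (∀ i, d ≤ dom (a i)) ∧ d ≤ dom (x ≫ f.base) := by
  have h : dom (f.ev a x) =
      dom (tuple (fun k => a ((Finite.equivFin ι).symm k)) x) ⊓ dom (x ≫ f.base) := by
    rw [← dom_restr, ← Category.assoc, ← tuple_last, Category.assoc]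
    apply Dom.ext
    change rst (f.ev a x) = rst _
    rw [Hom.ev, ← rst_comp_rst, f.rst_app, rst_comp_rst]
  rw [h, le_inf_iff, le_dom_tuple]
  constructor
  · rintro ⟨⟨h1, -⟩, h2⟩
    exact ⟨fun i => by simpa using h1 (Finite.equivFin ι i), h2⟩
  · rintro ⟨h1, h2⟩
    exact ⟨⟨fun i => h1 _, h2.trans (dom_comp_le _ _)⟩, h2⟩

theorem ev_update_add [DecidableEq ι] (f : Hom X Y) (a : ι → (Z ⟶ X.mon.carrier)) (x : Z ⟶ X.pt) (i : ι)
    (u v : Z ⟶ X.mon.carrier) :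
    f.ev (Function.update a i (u + v)) x =
      f.ev (Function.update a i u) x + f.ev (Function.update a i v) x := by
  have key : ∀ w, (fun k => Function.update a i w ((Finite.equivFin ι).symm k)) =
      Function.update (fun k => a ((Finite.equivFin ι).symm k)) (Finite.equivFin ι i) w := by
    intro w
    have := Function.update_comp_equiv a (Finite.equivFin ι).symm i w
    simpa [Function.comp_def] using this
  simp only [Hom.ev, key]
  convert (f.additive (Nat.card ι) Nat.card_pos Z
    (fun k => a ((Finite.equivFin ι).symm k)) x (Finite.equivFin ι i)).1 u v

theorem ev_update_zero [DecidableEq ι] (f : Hom X Y) (a : ι → (Z ⟶ X.mon.carrier)) (x : Z ⟶ X.pt) (i : ι) :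
    f.ev (Function.update a i 0) x = (dom (f.ev (Function.update a i 0) x)).1 ≫ 0 := by
  have key : ∀ w, (fun k => Function.update a i w ((Finite.equivFin ι).symm k)) =
      Function.update (fun k => a ((Finite.equivFin ι).symm k)) (Finite.equivFin ι i) w := by
    intro w
    have := Function.update_comp_equiv a (Finite.equivFin ι).symm i w
    simpa [Function.comp_def] using this
  simp only [Hom.ev, key]
  convert (f.additive (Nat.card ι) Nat.card_pos Z
    (fun k => a ((Finite.equivFin ι).symm k)) x (Finite.equivFin ι i)).2
  simp only [dom]


theorem app_eq_ev (f : Hom X Y) (n : ℕ) (hn : 0 < n) :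
    haveI : Nonempty (Fin n) := ⟨⟨0, hn⟩⟩
    f.app n hn = f.ev (powProj X.mon.carrier X.pt n) (powLast X.mon.carrier X.pt n) := by
  have : Nonempty (Fin n) := ⟨⟨0, hn⟩⟩
  rw [ev_eq_tuple f _ _ hn (Equiv.refl _)]
  simp [tuple_eta]

end ev

end Faa

namespace TotalCommMonoid

variable {C : Type u} [Category.{v} C] [CartesianRestrictionCategory C]
  {A : TotalCommMonoid C} {W Z : C}

theorem comp_sum (h : W ⟶ Z) {J : Type} (s : Finset J) (hs : s.Nonempty)
    (b : J → (Z ⟶ A.carrier)) : h ≫ ∑ j ∈ s, b j = ∑ j ∈ s, h ≫ b j := by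
  classical
  induction hs using Finset.Nonempty.cons_induction with
  | singleton j => simp
  | cons j s hj hs ih => rw [Finset.sum_cons, Finset.sum_cons, comp_add, ih]

theorem le_dom_sum {J : Type} (s : Finset J) (b : J → (Z ⟶ A.carrier)) (d : Dom Z) :
    d ≤ dom (∑ j ∈ s, b j) ↔ ∀ j ∈ s, d ≤ dom (b j) := by
  classical
  induction s using Finset.cons_induction with
  | empty => simp [dom_zero]
  | cons j s hj ih => rw [Finset.sum_cons, dom_add, le_inf_iff, ih]; simp

theorem restr_zero_add (d e : Dom Z) :
    d.1 ≫ (0 : Z ⟶ A.carrier) + e.1 ≫ 0 = (d ⊓ e).1 ≫ 0 := by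
  rw [restr_add, hom_add_comm, restr_add, hom_zero_add, restr_comp]

theorem eq_restr_zero {k : Z ⟶ A.carrier} {c : Dom Z} (h : k = c.1 ≫ 0) :
    k = (dom k).1 ≫ 0 := by
  subst h
  rw [dom_restr, dom_zero, inf_top_eq]

theorem sum_eq_restr_zero {J : Type} (s : Finset J) (b : J → (Z ⟶ A.carrier))
    (h : ∀ j ∈ s, b j = (dom (b j)).1 ≫ 0) :
    ∑ j ∈ s, b j = (dom (∑ j ∈ s, b j)).1 ≫ 0 := by
  classical
  induction s using Finset.cons_induction with
  | empty => rw [Finset.sum_empty, dom_zero]; exact (Category.id_comp _).symm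
  | cons j s hj ih =>
    rw [Finset.sum_cons, dom_add, ← restr_zero_add, ← h j (by simp),
      ← ih fun k hk => h k (by simp [hk])]

end TotalCommMonoid

namespace Faa

open TotalCommMonoid

variable {C : Type u} [Category.{v} C] [CartesianRestrictionCategory C]

instance finite_setoid (ι : Type) [Finite ι] : Finite (Setoid ι) :=
  Finite.of_injective (fun (P : Setoid ι) (i j : ι) => P i j) fun _ _ h =>
    Setoid.ext fun i j => iff_of_eq (congrFun (congrFun h i) j)

/-- The finitely many partitions of a finite type, as equivalence relations. -/
noncomputable instance fintypeSetoid (ι : Type) [Finite ι] : Fintype (Setoid ι) :=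
  Fintype.ofFinite _

/-- The block of a partition `P` which corresponds to a point of the quotient by `P`. -/
abbrev Block {ι : Type} (P : Setoid ι) (q : Quotient P) : Type :=
  {i : ι // Quotient.mk P i = q}

instance nonempty_quotient {ι : Type} [Nonempty ι] (P : Setoid ι) : Nonempty (Quotient P) :=
  ‹Nonempty ι›.map (Quotient.mk P)

instance nonempty_block {ι : Type} (P : Setoid ι) (q : Quotient P) : Nonempty (Block P q) := by
  obtain ⟨i, hi⟩ := Quotient.exists_rep q
  exact ⟨⟨i, hi⟩⟩

/-- The Faà di Bruno formula: the sum, over all partitions `P` of the index type `ι`, of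
`⟨⟨a_i (i ∈ B_1), x⟩ f_{|B_1|}, …, ⟨a_i (i ∈ B_k), x⟩ f_{|B_k|}, x f_*⟩ g_k`,
where `B_1, …, B_k` are the blocks of `P`. -/
noncomputable def compEv {X Y V : Faa C} (f : Hom X Y) (g : Hom Y V) {ι : Type} [Finite ι]
    [Nonempty ι] {Z : C} (a : ι → (Z ⟶ X.mon.carrier)) (x : Z ⟶ X.pt) : Z ⟶ V.mon.carrier :=
  ∑ P : Setoid ι, g.ev (fun q : Quotient P => f.ev (fun i : Block P q => a i) x) (x ≫ f.base)

section compEv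

variable {X Y V : Faa C} (f : Hom X Y) (g : Hom Y V) {Z W : C} {ι ι' : Type} [Finite ι]
  [Nonempty ι] [Finite ι'] [Nonempty ι']

theorem comp_compEv (h : W ⟶ Z) (a : ι → (Z ⟶ X.mon.carrier)) (x : Z ⟶ X.pt) :
    h ≫ compEv f g a x = compEv f g (fun i => h ≫ a i) (h ≫ x) := by
  rw [compEv, comp_sum _ _ ⟨⊥, Finset.mem_univ _⟩]
  simp only [comp_ev, compEv, Category.assoc]

theorem compEv_congr {a : ι → (Z ⟶ X.mon.carrier)} {a' : ι' → (Z ⟶ X.mon.carrier)}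
    (x : Z ⟶ X.pt) (e : ι ≃ ι') (h : ∀ i, a i = a' (e i)) :
    compEv f g a x = compEv f g a' x := by
  have hE : Function.Bijective (fun P : Setoid ι' => Setoid.comap e P) := by
    refine Function.bijective_iff_has_inverse.2 ⟨fun P => Setoid.comap e.symm P, ?_, ?_⟩
    · intro P; ext i j; simp [Setoid.comap_rel]
    · intro P; ext i j; simp [Setoid.comap_rel]
  symm
  refine Fintype.sum_bijective _ hE _ _ fun P => ?_
  let E : Quotient (Setoid.comap e P) ≃ Quotient P :=
    Quotient.congr e fun i j => Iff.rfl
  symm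
  refine ev_congr g _ E fun q => ?_
  refine ev_congr f _ (e.subtypeEquiv fun i => ?_) fun i => h _
  constructor
  · rintro rfl; rfl
  · intro hi; apply E.injective; rw [← hi]; rfl

open Classical in
theorem block_update [DecidableEq ι] (a : ι → (Z ⟶ X.mon.carrier)) (x : Z ⟶ X.pt) (i : ι) (P : Setoid ι)
    (w : Z ⟶ X.mon.carrier) :
    (fun q : Quotient P => f.ev (fun j : Block P q => Function.update a i w j) x) =
      Function.update (fun q : Quotient P => f.ev (fun j : Block P q => a j) x) (Quotient.mk P i)
        (f.ev (Function.update (fun j : Block P (Quotient.mk P i) => a j) ⟨i, rfl⟩ w) x) := by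
  funext q
  by_cases hq : q = Quotient.mk P i
  · subst hq
    rw [Function.update_self]
    congr 1
    funext j
    by_cases hj : j = ⟨i, rfl⟩
    · subst hj; simp
    · rw [Function.update_of_ne hj, Function.update_of_ne]
      intro h; exact hj (Subtype.ext h)
  · rw [Function.update_of_ne hq]
    congr 1
    funext j
    rw [Function.update_of_ne]
    rintro rfl
    exact hq j.2.symm

open Classical in
theorem compEv_update_add [DecidableEq ι] (a : ι → (Z ⟶ X.mon.carrier)) (x : Z ⟶ X.pt) (i : ι)
    (u v : Z ⟶ X.mon.carrier) :
    compEv f g (Function.update a i (u + v)) x =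
      compEv f g (Function.update a i u) x + compEv f g (Function.update a i v) x := by
  simp only [compEv, ← Finset.sum_add_distrib]
  refine Finset.sum_congr rfl fun P _ => ?_
  rw [block_update, block_update, block_update, ev_update_add, ev_update_add]

/-- A component evaluated at a tuple with a restricted zero entry is a restricted zero. -/
theorem ev_eq_zero (a : ι → (Z ⟶ X.mon.carrier)) (x : Z ⟶ X.pt) (i : ι) (d : Dom Z)
    (h : a i = d.1 ≫ 0) : f.ev a x = (dom (f.ev a x)).1 ≫ 0 := by
  classical
  have h1 : f.ev a x = (dom (f.ev a x)).1 ≫ f.ev (Function.update a i 0) x := by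
    nth_rewrite 1 [← (restr_eq_iff _ (f.ev a x)).2 le_rfl]
    rw [comp_ev, comp_ev]
    congr 1
    funext j
    by_cases hj : j = i
    · subst hj
      rw [Function.update_self, h, restr_comp, inf_of_le_left]
      have := ((le_dom_ev f a x _).1 le_rfl).1 j
      rw [h, dom_restr, dom_zero, inf_top_eq] at this
      exact this
    · rw [Function.update_of_ne hj]
  rw [ev_update_zero, restr_comp] at h1
  exact eq_restr_zero h1

theorem le_dom_term (a : ι → (Z ⟶ X.mon.carrier)) (x : Z ⟶ X.pt) (P : Setoid ι) (d : Dom Z) :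
    d ≤ dom (g.ev (fun q : Quotient P => f.ev (fun i : Block P q => a i) x) (x ≫ f.base)) ↔
      (∀ i, d ≤ dom (a i)) ∧ d ≤ dom (x ≫ f.base ≫ g.base) := by
  simp only [le_dom_ev, Category.assoc]
  constructor
  · intro h
    exact ⟨fun i => (h.1 (Quotient.mk _ i)).1 ⟨i, rfl⟩, h.2⟩
  · rintro ⟨h1, h2⟩
    refine ⟨fun q => ⟨fun i => h1 _, h2.trans ?_⟩, h2⟩
    rw [← Category.assoc]
    exact dom_comp_le _ _

theorem le_dom_compEv (a : ι → (Z ⟶ X.mon.carrier)) (x : Z ⟶ X.pt) (d : Dom Z) :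
    d ≤ dom (compEv f g a x) ↔ (∀ i, d ≤ dom (a i)) ∧ d ≤ dom (x ≫ f.base ≫ g.base) := by
  simp only [compEv, le_dom_sum, le_dom_term, Finset.mem_univ, forall_true_left]
  exact ⟨fun h => h ⊥, fun h _ => h⟩

/-- Only one partition contributes if all others give restricted zeros. -/
theorem compEv_eq_term (a : ι → (Z ⟶ X.mon.carrier)) (x : Z ⟶ X.pt) (P : Setoid ι)
    (t : Z ⟶ V.mon.carrier)
    (hP : g.ev (fun q : Quotient P => f.ev (fun i : Block P q => a i) x) (x ≫ f.base) = t)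
    (h : ∀ Q : Setoid ι, Q ≠ P → ∃ d : Dom Z,
      g.ev (fun q : Quotient Q => f.ev (fun i : Block Q q => a i) x) (x ≫ f.base) = d.1 ≫ 0) :
    compEv f g a x = t := by
  classical
  rw [compEv, ← Finset.sum_erase_add _ _ (Finset.mem_univ P), hP]
  rw [sum_eq_restr_zero, restr_add, hom_zero_add, restr_eq_iff, le_dom_sum]
  · intro Q _
    rw [← hP, le_dom_term, ← le_dom_term f g a x P]
  · intro Q hQ
    obtain ⟨d, hd⟩ := h Q (Finset.ne_of_mem_erase hQ)
    exact eq_restr_zero hd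

open Classical in
theorem compEv_update_zero [DecidableEq ι] (a : ι → (Z ⟶ X.mon.carrier)) (x : Z ⟶ X.pt) (i : ι) :
    compEv f g (Function.update a i 0) x =
      (dom (compEv f g (Function.update a i 0) x)).1 ≫ 0 := by
  refine sum_eq_restr_zero _ _ fun P _ => ?_
  refine ev_eq_zero g _ _ (Quotient.mk P i) _ (ev_eq_zero f _ x ⟨i, rfl⟩ ⊤ ?_)
  simp only [Function.update_self]
  exact (Category.id_comp _).symm

theorem tuple_compEv {n : ℕ} [Nonempty (Fin n)] (a : Fin n → (Z ⟶ X.mon.carrier))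
    (x : Z ⟶ X.pt) :
    tuple a x ≫ compEv f g (powProj X.mon.carrier X.pt n) (powLast X.mon.carrier X.pt n) =
      compEv f g a x := by
  rw [comp_compEv]
  simp only [tuple_proj, tuple_last]
  rw [← comp_compEv, restr_eq_iff, le_dom_tuple]
  have h := (le_dom_compEv f g a x _).1 le_rfl
  exact ⟨h.1, h.2.trans (dom_comp_le _ _)⟩

end compEv

/-- Composition in the Faà di Bruno category. -/
noncomputable def Hom.comp {X Y V : Faa C} (f : Hom X Y) (g : Hom Y V) : Hom X V where
  base := f.base ≫ g.base
  app n hn :=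
    haveI : Nonempty (Fin n) := ⟨⟨0, hn⟩⟩
    compEv f g (powProj X.mon.carrier X.pt n) (powLast X.mon.carrier X.pt n)
  rst_app n hn := by
    have : Nonempty (Fin n) := ⟨⟨0, hn⟩⟩
    refine congrArg Dom.val (a₁ := dom _) (a₂ := dom _) (eq_of_forall_le_iff fun d => ?_)
    rw [le_dom_compEv]
    refine and_iff_right fun i => ?_
    rw [(isTotal_iff _).1 (powProj_total n i)]
    exact le_top
  additive n hn Z a x i := by
    have : Nonempty (Fin n) := ⟨⟨0, hn⟩⟩
    constructor
    · intro u v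
      simp only [tuple_compEv]
      exact compEv_update_add f g a x i u v
    · simp only [tuple_compEv]
      exact compEv_update_zero f g a x i
  symmetric n hn Z a x σ := by
    have : Nonempty (Fin n) := ⟨⟨0, hn⟩⟩
    simp only [tuple_compEv]
    exact compEv_congr f g x σ fun i => rfl

section restriction

/-- The `n`-th component of the map `restOf` below, for `n ≥ 1`: the restriction of `π_n h` followed
by `π_0` if `n = 1`, and by `0` if `n ≥ 2`. -/
noncomputable def restApp (X : Faa C) {T : C} (h : X.pt ⟶ T) (n : ℕ) (hn : 0 < n) :
    powProd X.mon.carrier X.pt n ⟶ X.mon.carrier :=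
  rst (powLast X.mon.carrier X.pt n ≫ h) ≫
    (if n = 1 then powProj X.mon.carrier X.pt n ⟨0, hn⟩ else 0)

variable {X Y : Faa C} {T Z : C} (h : X.pt ⟶ T)

theorem dom_tuple_comp_last {n : ℕ} (a : Fin n → (Z ⟶ X.mon.carrier)) (x : Z ⟶ X.pt) :
    dom (tuple a x ≫ powLast X.mon.carrier X.pt n ≫ h) = dom (tuple a x) ⊓ dom (x ≫ h) := by
  rw [← Category.assoc, tuple_last, Category.assoc, dom_restr]

theorem tuple_restApp {n : ℕ} (hn : 0 < n) (a : Fin n → (Z ⟶ X.mon.carrier)) (x : Z ⟶ X.pt) :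
    tuple a x ≫ restApp X h n hn =
      (dom (tuple a x) ⊓ dom (x ≫ h)).1 ≫ (if n = 1 then a ⟨0, hn⟩ else 0) := by
  have h1 := comp_rst (tuple a x) (powLast X.mon.carrier X.pt n ≫ h)
  change _ = (dom _).1 ≫ _ at h1
  rw [dom_tuple_comp_last] at h1
  rw [restApp, ← Category.assoc, h1, Category.assoc]
  split_ifs
  · rw [tuple_proj, restr_comp, inf_right_comm, inf_idem]
  · rw [comp_zero, restr_comp, inf_right_comm, inf_idem]

theorem dom_update_add {n : ℕ} (a : Fin n → (Z ⟶ X.mon.carrier)) (x : Z ⟶ X.pt) (i : Fin n)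
    (u v : Z ⟶ X.mon.carrier) :
    dom (tuple (Function.update a i (u + v)) x) =
      dom (tuple (Function.update a i u) x) ⊓ dom (tuple (Function.update a i v) x) := by
  refine eq_of_forall_le_iff fun d => ?_
  simp only [le_inf_iff, le_dom_tuple,
    Function.forall_update_iff a (p := fun _ w => d ≤ dom w), dom_add]
  tauto

/-- The sequence `(rst h, rst (π_1 h) π_0, rst (π_2 h) 0, rst (π_3 h) 0, …)`. -/
noncomputable def restOf (X : Faa C) {T : C} (h : X.pt ⟶ T) : Hom X X where
  base := rst h
  app n hn := restApp X h n hn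
  rst_app n hn := by
    refine congrArg Dom.val (a₁ := dom _) (a₂ := dom _) ?_
    have h1 : dom (powLast X.mon.carrier X.pt n ≫ rst h) = dom (powLast X.mon.carrier X.pt n ≫ h) :=
      Dom.ext (rst_comp_rst _ _)
    rw [h1, restApp]
    change dom ((dom _).1 ≫ _) = _
    rw [dom_restr]
    split_ifs
    · rw [(isTotal_iff _).1 (powProj_total n _), inf_top_eq]
    · rw [dom_zero, inf_top_eq]
  additive n hn Z a x i := by
    simp only [tuple_restApp]
    constructor
    · intro u v
      rw [restr_add, hom_add_comm _ (_ ≫ _), restr_add, restr_comp, dom_update_add]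
      have e : ∀ d d' c : Dom Z, d ⊓ d' ⊓ c = d ⊓ c ⊓ (d' ⊓ c) := fun d d' c =>
        (inf_inf_distrib_right d d' c)
      rw [e]
      split_ifs with h1
      · subst h1
        obtain rfl : i = ⟨0, hn⟩ := Subsingleton.elim _ _
        simp only [Function.update_self]
        rw [hom_add_comm]
      · rw [hom_zero_add]
    · refine eq_restr_zero (c := dom (tuple (Function.update a i 0) x) ⊓ dom (x ≫ h)) ?_
      split_ifs with h1
      · subst h1
        obtain rfl : i = ⟨0, hn⟩ := Subsingleton.elim _ _
        rw [Function.update_self]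
      · rfl
  symmetric n hn Z a x σ := by
    simp only [tuple_restApp]
    have h1 : dom (tuple (fun i => a (σ i)) x) = dom (tuple a x) :=
      eq_of_forall_le_iff fun d => by
        rw [le_dom_tuple, le_dom_tuple, σ.forall_congr_left]
        simp
    rw [h1]
    split_ifs with h2
    · subst h2
      congr 2
      exact Subsingleton.elim _ _
    · rfl

variable {ι : Type} [Finite ι] [Nonempty ι]

theorem restOf_ev_subsingleton [Subsingleton ι] (a : ι → (Z ⟶ X.mon.carrier)) (x : Z ⟶ X.pt)
    (i : ι) : (restOf X h).ev a x = (dom (x ≫ h)).1 ≫ a i := by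
  have : Unique ι := uniqueOfSubsingleton i
  rw [ev_eq_tuple (restOf X h) a x one_pos (Equiv.ofUnique (Fin 1) ι)]
  refine (tuple_restApp h _ _ x).trans ?_
  have h1 : dom (tuple (fun k => a (Equiv.ofUnique (Fin 1) ι k)) x) ⊓ dom (x ≫ h) =
      dom (x ≫ h) ⊓ dom (a i) := by
    refine eq_of_forall_le_iff fun d => ?_
    simp only [le_inf_iff, le_dom_tuple, Subsingleton.elim _ i]
    constructor
    · rintro ⟨⟨h1, -⟩, h2⟩
      exact ⟨h2, h1 0⟩
    · rintro ⟨h1, h2⟩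
      exact ⟨⟨fun _ => h2, h1.trans (dom_comp_le _ _)⟩, h1⟩
  rw [if_pos rfl, Subsingleton.elim (Equiv.ofUnique (Fin 1) ι ⟨0, one_pos⟩) i, h1, ← restr_comp,
    (restr_eq_iff _ (a i)).2 le_rfl]

theorem restOf_ev_nontrivial [Nontrivial ι] (a : ι → (Z ⟶ X.mon.carrier)) (x : Z ⟶ X.pt) :
    ∃ d : Dom Z, (restOf X h).ev a x = d.1 ≫ 0 := by
  refine ⟨dom (tuple (fun k => a ((Finite.equivFin ι).symm k)) x) ⊓ dom (x ≫ h),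
    (tuple_restApp h Nat.card_pos _ x).trans ?_⟩
  rw [if_neg]
  exact (Finite.one_lt_card).ne'

theorem restOf_compEv (g : Hom X Y) (a : ι → (Z ⟶ X.mon.carrier)) (x : Z ⟶ X.pt) :
    compEv (restOf X h) g a x = (dom (x ≫ h)).1 ≫ g.ev a x := by
  refine compEv_eq_term _ _ a x ⊥ _ ?_ ?_
  · rw [comp_ev]
    have h1 : x ≫ (restOf X h).base = (dom (x ≫ h)).1 ≫ x := comp_rst x h
    rw [h1]
    refine (ev_congr g _ (Equiv.ofBijective (Quotient.mk (⊥ : Setoid ι))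
      ⟨fun i j hij => Quotient.exact hij, Quotient.mk_surjective⟩) fun i => ?_).symm
    have : Subsingleton (Block (⊥ : Setoid ι) (Quotient.mk ⊥ i)) :=
      ⟨fun j k => Subtype.ext (Quotient.exact (j.2.trans k.2.symm))⟩
    exact (restOf_ev_subsingleton h (fun j : Block (⊥ : Setoid ι) (Quotient.mk ⊥ i) => a j) x
      ⟨i, rfl⟩).symm
  · intro Q hQ
    have : ∃ i j, Q i j ∧ i ≠ j := by
      by_contra hc
      push Not at hc
      exact hQ (le_bot_iff.1 fun i j hij => hc i j hij)
    obtain ⟨i, j, hij, hne⟩ := this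
    have : Nontrivial (Block Q (Quotient.mk Q i)) :=
      ⟨⟨i, rfl⟩, ⟨j, Quotient.sound (Q.symm hij)⟩, fun he => hne (congrArg Subtype.val he)⟩
    obtain ⟨d, hd⟩ := restOf_ev_nontrivial h (fun j : Block Q (Quotient.mk Q i) => a j) x
    exact ⟨_, ev_eq_zero g _ _ (Quotient.mk Q i) d hd⟩

theorem compEv_restOf (f : Hom Y X) (a : ι → (Z ⟶ Y.mon.carrier)) (x : Z ⟶ Y.pt) :
    compEv f (restOf X h) a x = (dom (x ≫ f.base ≫ h)).1 ≫ f.ev a x := by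
  refine compEv_eq_term _ _ a x ⊤ _ ?_ ?_
  · obtain ⟨i⟩ := ‹Nonempty ι›
    have : Subsingleton (Quotient (⊤ : Setoid ι)) := Quotient.subsingleton_iff.2 rfl
    rw [restOf_ev_subsingleton h _ _ (Quotient.mk _ i), Category.assoc]
    congr 1
    refine ev_congr f x (Equiv.subtypeUnivEquiv fun j => Subsingleton.elim _ _) fun j => rfl
  · intro Q hQ
    have : Nontrivial (Quotient Q) := by
      rw [← not_subsingleton_iff_nontrivial, Quotient.subsingleton_iff]
      exact hQ
    exact restOf_ev_nontrivial h _ _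

end restriction
end Faa

namespace Faa

open TotalCommMonoid

variable {C : Type u} [Category.{v} C] [CartesianRestrictionCategory C]

section assoc

theorem add_multi_sum {M N : Type*} [AddCommMonoid M] [AddCommMonoid N] (n : ℕ)
    (F : (Fin n → M) → N)
    (hF : ∀ (a : Fin n → M) (i : Fin n) (u v : M), F (Function.update a i (u + v)) =
      F (Function.update a i u) + F (Function.update a i v))
    (J : Fin n → Type) [∀ i, Fintype (J i)] [∀ i, Nonempty (J i)] (b : ∀ i, J i → M) :
    F (fun i => ∑ j, b i j) = ∑ k : ∀ i, J i, F (fun i => b i (k i)) := by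
  induction n with
  | zero =>
    rw [Fintype.sum_unique]
    congr 1
    funext i
    exact i.elim0
  | succ n ih =>
    have h0 : ∀ (s : Finset (J 0)) (t : Fin n → M), s.Nonempty →
        F (Fin.cons (∑ j ∈ s, b 0 j) t) = ∑ j ∈ s, F (Fin.cons (b 0 j) t) := by
      classical
      intro s t hs
      induction hs using Finset.Nonempty.cons_induction with
      | singleton j => simp
      | cons j s hj hs ih =>
        have h1 := hF (Fin.cons 0 t) 0 (b 0 j) (∑ j ∈ s, b 0 j)
        simp only [Fin.update_cons_zero] at h1
        rw [Finset.sum_cons, Finset.sum_cons, h1, ih]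
    have h1 : (fun i => ∑ j, b i j) = Fin.cons (∑ j, b 0 j) (fun i => ∑ j, b (Fin.succ i) j) := by
      funext i
      refine Fin.cases ?_ (fun i => ?_) i <;> simp
    rw [h1, h0 _ _ Finset.univ_nonempty, ← (Fin.consEquiv J).sum_comp, Fintype.sum_prod_type]
    refine Finset.sum_congr rfl fun j _ => ?_
    rw [ih (fun t => F (Fin.cons (b 0 j) t)) ?_ (fun i => J i.succ) (fun i => b i.succ)]
    · refine Finset.sum_congr rfl fun k _ => ?_
      congr 1
      funext i
      refine Fin.cases ?_ (fun i => ?_) i <;> simp [Fin.consEquiv]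
    · intro t i u v
      simp only [Fin.cons_update]
      exact hF _ _ _ _

variable {X Y V U : Faa C} {Z : C} {ι : Type} [Finite ι] [Nonempty ι]

theorem ev_sum (f : Hom X Y) (J : ι → Type) [∀ i, Fintype (J i)] [∀ i, Nonempty (J i)]
    (b : ∀ i, J i → (Z ⟶ X.mon.carrier)) (x : Z ⟶ X.pt) [Fintype (∀ i, J i)] :
    f.ev (fun i => ∑ j, b i j) x = ∑ k : ∀ i, J i, f.ev (fun i => b i (k i)) x := by
  have e := (Finite.equivFin ι).symm
  rw [ev_eq_tuple f _ x Nat.card_pos e]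
  rw [add_multi_sum (Nat.card ι) (fun a => tuple a x ≫ f.app (Nat.card ι) Nat.card_pos)
    (fun a i u v => (f.additive _ Nat.card_pos Z a x i).1 u v) (fun k => J (e k))
    (fun k => b (e k))]
  rw [← (Equiv.piCongrLeft J e).sum_comp]
  refine Finset.sum_congr rfl fun k _ => ?_
  rw [ev_eq_tuple f _ x Nat.card_pos e]
  congr 2
  funext i
  rw [Equiv.piCongrLeft_apply_apply]

theorem ev_comp (f : Hom X Y) (g : Hom Y V) (a : ι → (Z ⟶ X.mon.carrier)) (x : Z ⟶ X.pt) :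
    (f.comp g).ev a x = compEv f g a x := by
  have : Nonempty (Fin (Nat.card ι)) := ⟨⟨0, Nat.card_pos⟩⟩
  exact (tuple_compEv f g _ x).trans
    (compEv_congr f g x (Finite.equivFin ι).symm fun i => rfl)

/-- The points of the quotient by `R` which lie over a point of the quotient by `P`. -/
abbrev Over (R P : Setoid ι) (q : Quotient P) : Type :=
  {r : Quotient R // ∃ i, Quotient.mk R i = r ∧ Quotient.mk P i = q}

instance nonempty_over (R P : Setoid ι) (q : Quotient P) : Nonempty (Over R P q) := by
  obtain ⟨i, hi⟩ := Quotient.exists_rep q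
  exact ⟨⟨Quotient.mk R i, i, rfl, hi⟩⟩

/-- The summand of a triple composite which belongs to a pair of partitions. -/
noncomputable def tripleTerm (f : Hom X Y) (g : Hom Y V) (h : Hom V U)
    (a : ι → (Z ⟶ X.mon.carrier)) (x : Z ⟶ X.pt) (R P : Setoid ι) : Z ⟶ U.mon.carrier :=
  h.ev (fun q : Quotient P => g.ev (fun r : Over R P q =>
    f.ev (fun i : Block R r.1 => a i) x) (x ≫ f.base)) ((x ≫ f.base) ≫ g.base)

/-- Glue partitions of the blocks of `P` to a partition. -/
def glue (P : Setoid ι) (Q : ∀ q : Quotient P, Setoid (Block P q)) : Setoid ι where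
  r i j := ∃ (q : Quotient P) (hi : Quotient.mk P i = q) (hj : Quotient.mk P j = q),
    Q q ⟨i, hi⟩ ⟨j, hj⟩
  iseqv := by
    refine ⟨fun i => ⟨_, rfl, rfl, (Q _).refl _⟩, ?_, ?_⟩
    · rintro i j ⟨q, hi, hj, hq⟩
      exact ⟨q, hj, hi, (Q q).symm hq⟩
    · rintro i j k ⟨q, hi, hj, hq⟩ ⟨q', hj', hk, hq'⟩
      obtain rfl : q = q' := hj.symm.trans hj'
      exact ⟨q, hi, hk, (Q q).trans hq hq'⟩

theorem left_term (f : Hom X Y) (g : Hom Y V)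
    (a : ι → (Z ⟶ X.mon.carrier)) (x : Z ⟶ X.pt) (R P : Setoid ι) (hR : R ≤ P) (q : Quotient P)
    (Q : Setoid (Block P q)) (hQ : ∀ i j, Q i j ↔ R i.1 j.1) :
    g.ev (fun r : Quotient Q => f.ev (fun i : Block Q r => a i.1.1) x) (x ≫ f.base) =
      g.ev (fun r : Over R P q => f.ev (fun i : Block R r.1 => a i) x) (x ≫ f.base) := by
  let E : Quotient Q ≃ Over R P q := Equiv.ofBijective
    (Quotient.lift (fun i : Block P q => (⟨Quotient.mk R i.1, i.1, rfl, i.2⟩ : Over R P q))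
      fun i j hij => Subtype.ext (Quotient.sound ((hQ i j).1 hij))) (by
    constructor
    · intro r s
      induction r, s using Quotient.inductionOn₂ with | h i j => ?_
      intro hij
      exact Quotient.sound ((hQ i j).2 (Quotient.exact (congrArg Subtype.val hij)))
    · rintro ⟨r, i, rfl, hi⟩
      exact ⟨Quotient.mk Q ⟨i, hi⟩, rfl⟩)
  refine ev_congr g _ E fun r => ?_
  induction r using Quotient.inductionOn with | h i => ?_
  refine ev_congr f _ (Equiv.ofBijective (fun j : Block Q (Quotient.mk Q i) =>
    (⟨j.1.1, Quotient.sound ((hQ _ _).1 (Quotient.exact j.2))⟩ :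
      Block R (E (Quotient.mk Q i)).1)) ?_) fun j => rfl
  constructor
  · intro j k hjk
    have hjk' := congrArg Subtype.val hjk
    exact Subtype.ext (Subtype.ext hjk')
  · rintro ⟨j, hj⟩
    have hj' : R j i.1 := Quotient.exact hj
    exact ⟨⟨⟨j, (Quotient.sound (hR hj')).trans i.2⟩, Quotient.sound ((hQ _ _).2 hj')⟩, rfl⟩

open Classical in
theorem left_sum (f : Hom X Y) (g : Hom Y V) (h : Hom V U)
    (a : ι → (Z ⟶ X.mon.carrier)) (x : Z ⟶ X.pt) (P : Setoid ι) :
    h.ev (fun q : Quotient P => (f.comp g).ev (fun i : Block P q => a i) x)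
      ((x ≫ f.base) ≫ g.base) =
    ∑ R ∈ Finset.univ.filter (fun R : Setoid ι => R ≤ P), tripleTerm f g h a x R P := by
  let : Fintype (∀ q : Quotient P, Setoid (Block P q)) := Fintype.ofFinite _
  simp only [ev_comp, compEv]
  rw [ev_sum h (fun q : Quotient P => Setoid (Block P q))]
  refine Finset.sum_nbij' (fun Q => glue P Q)
    (fun R q => Setoid.comap (Subtype.val : Block P q → ι) R) ?_ ?_ ?_ ?_ ?_
  · intro Q _
    simp only [Finset.mem_filter, Finset.mem_univ, true_and]
    rintro i j ⟨q, hi, hj, -⟩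
    exact Quotient.exact (hi.trans hj.symm)
  · intro R _
    exact Finset.mem_univ _
  · intro Q _
    funext q
    ext ⟨i, hi⟩ ⟨j, hj⟩
    constructor
    · rintro ⟨q', hi', hj', hq⟩
      obtain rfl : q' = q := hi'.symm.trans hi
      exact hq
    · intro hq
      exact ⟨q, hi, hj, hq⟩
  · intro R hR
    simp only [Finset.mem_filter, Finset.mem_univ, true_and] at hR
    ext i j
    constructor
    · rintro ⟨q, hi, hj, hq⟩
      exact hq
    · intro hq
      exact ⟨_, rfl, Quotient.sound (P.symm (hR hq)), hq⟩
  · intro Q hQ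
    have hP : glue P Q ≤ P := by
      rintro i j ⟨q, hi, hj, -⟩
      exact Quotient.exact (hi.trans hj.symm)
    rw [tripleTerm]
    congr 1
    funext q
    refine left_term f g a x (glue P Q) P hP q (Q q) ?_
    rintro ⟨i, hi⟩ ⟨j, hj⟩
    constructor
    · intro hq
      exact ⟨q, hi, hj, hq⟩
    · rintro ⟨q', hi', hj', hq⟩
      obtain rfl : q' = q := hi'.symm.trans hi
      exact hq

open Classical in
theorem right_sum (f : Hom X Y) (g : Hom Y V) (h : Hom V U)
    (a : ι → (Z ⟶ X.mon.carrier)) (x : Z ⟶ X.pt) (R : Setoid ι) :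
    (g.comp h).ev (fun r : Quotient R => f.ev (fun i : Block R r => a i) x) (x ≫ f.base) =
    ∑ P ∈ Finset.univ.filter (fun P : Setoid ι => R ≤ P), tripleTerm f g h a x R P := by
  simp only [ev_comp, compEv]
  refine Finset.sum_nbij (fun S => Setoid.comap (Quotient.mk R) S) ?_ ?_ ?_ ?_
  · intro S _
    simp only [Finset.mem_filter, Finset.mem_univ, true_and]
    intro i j hij
    rw [Setoid.comap_rel, Quotient.sound hij]
  · intro S _ S' _ hS
    ext r s
    induction r, s using Quotient.inductionOn₂ with | h i j => ?_
    exact iff_of_eq (congrArg (fun P : Setoid ι => P i j) hS)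
  · intro P hP
    simp only [Finset.coe_filter, Finset.mem_univ, true_and, Set.mem_ofPred_eq] at hP
    exact ⟨Setoid.correspondence R ⟨P, hP⟩, by simp,
      congrArg Subtype.val ((Setoid.correspondence R).symm_apply_apply ⟨P, hP⟩)⟩
  · intro S _
    let P := Setoid.comap (Quotient.mk R) S
    let E : Quotient P ≃ Quotient S := Equiv.ofBijective
      (Quotient.lift (fun i => Quotient.mk S (Quotient.mk R i))
        fun i j hij => Quotient.sound hij) (by
      constructor
      · intro r s
        induction r, s using Quotient.inductionOn₂ with | h i j => ?_
        intro hij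
        exact Quotient.sound (Quotient.exact hij : S _ _)
      · intro s
        induction s using Quotient.inductionOn with | h r => ?_
        induction r using Quotient.inductionOn with | h i => ?_
        exact ⟨Quotient.mk P i, rfl⟩)
    refine (ev_congr h _ E fun q => ?_).symm
    refine ev_congr g _ (Equiv.subtypeEquivRight fun r => ?_) fun r => rfl
    constructor
    · rintro ⟨i, rfl, rfl⟩
      rfl
    · intro hr
      induction r using Quotient.inductionOn with | h i => ?_
      exact ⟨i, rfl, E.injective hr⟩

theorem comp_assoc' (f : Hom X Y) (g : Hom Y V) (h : Hom V U) :
    (f.comp g).comp h = f.comp (g.comp h) := by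
  classical
  refine Hom.ext (Category.assoc _ _ _) ?_
  funext n hn
  have : Nonempty (Fin n) := ⟨⟨0, hn⟩⟩
  change compEv (f.comp g) h _ _ = compEv f (g.comp h) _ _
  unfold compEv
  have hl := left_sum f g h (powProj X.mon.carrier X.pt n) (powLast X.mon.carrier X.pt n)
  rw [Category.assoc] at hl
  refine (Finset.sum_congr rfl fun P _ => hl P).trans (Eq.trans ?_
    (Finset.sum_congr rfl fun R _ => (right_sum f g h _ _ R).symm))
  refine Finset.sum_comm' fun P R => ?_
  simp

end assoc

theorem restApp_id (X : Faa C) (n : ℕ) (hn : 0 < n) : restApp X (𝟙 X.pt) n hn =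
    if n = 1 then powProj X.mon.carrier X.pt n ⟨0, hn⟩ else 0 := by
  have h : rst (powLast X.mon.carrier X.pt n ≫ 𝟙 X.pt) = 𝟙 _ := by
    rw [Category.comp_id]
    exact powLast_total n
  rw [restApp, h, Category.id_comp]

/-- The identity map `(1, π_0, 0, 0, …)`. -/
noncomputable def Hom.id (X : Faa C) : Hom X X where
  base := 𝟙 X.pt
  app n hn := if n = 1 then powProj X.mon.carrier X.pt n ⟨0, hn⟩ else 0
  rst_app n hn := by
    rw [← restApp_id]
    refine ((restOf X (𝟙 X.pt)).rst_app n hn).trans ?_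
    change rst (_ ≫ rst (𝟙 X.pt)) = _
    rw [rst_id]
  additive n hn := by
    rw [← restApp_id]
    exact (restOf X (𝟙 X.pt)).additive n hn
  symmetric n hn := by
    rw [← restApp_id]
    exact (restOf X (𝟙 X.pt)).symmetric n hn

theorem id_eq_restOf (X : Faa C) : Hom.id X = restOf X (𝟙 X.pt) := by
  refine Hom.ext (rst_id X.pt).symm ?_
  funext n hn
  exact (restApp_id X n hn).symm

theorem restOf_comp_app {X Y : Faa C} {T : C} (h : X.pt ⟶ T) (g : Hom X Y) (n : ℕ) (hn : 0 < n) :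
    ((restOf X h).comp g).app n hn = rst (powLast X.mon.carrier X.pt n ≫ h) ≫ g.app n hn := by
  have : Nonempty (Fin n) := ⟨⟨0, hn⟩⟩
  rw [app_eq_ev g n hn]
  exact restOf_compEv h g _ _

theorem comp_restOf_app {X Y : Faa C} {T : C} (f : Hom X Y) (h : Y.pt ⟶ T) (n : ℕ) (hn : 0 < n) :
    (f.comp (restOf Y h)).app n hn =
      rst (powLast X.mon.carrier X.pt n ≫ f.base ≫ h) ≫ f.app n hn := by
  have : Nonempty (Fin n) := ⟨⟨0, hn⟩⟩
  rw [app_eq_ev f n hn]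
  exact compEv_restOf h f _ _

/-- The Faà di Bruno category, with `f ≫ g` given by the Faà di Bruno formula. -/
noncomputable instance instCategory : Category (Faa C) where
  Hom := Hom
  id := Hom.id
  comp := Hom.comp
  id_comp {X Y} f := by
    refine Hom.ext (Category.id_comp _) ?_
    funext n hn
    rw [id_eq_restOf, restOf_comp_app, Category.comp_id]
    exact (congrArg (· ≫ _) (powLast_total n)).trans (Category.id_comp _)
  comp_id {X Y} f := by
    refine Hom.ext (Category.comp_id _) ?_
    funext n hn
    rw [id_eq_restOf, comp_restOf_app, Category.comp_id, ← f.rst_app n hn, rst_comp_self]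
  assoc := comp_assoc'

/-- The restriction of `f` is `(rst f_*, rst (π_1 f_*) π_0, rst (π_2 f_*) 0, rst (π_3 f_*) 0, …)`. -/
noncomputable instance instRestrictionCategory : RestrictionCategory (Faa C) where
  rst {X Y} f := restOf X (Hom.base f)
  rst_comp_self {X Y} f := by
    refine Hom.ext (rst_comp_self _) ?_
    funext n hn
    refine (restOf_comp_app _ _ n hn).trans ?_
    rw [← Hom.rst_app f n hn, rst_comp_self]
  rst_comm {X Y V} f g := by
    refine Hom.ext (rst_comm _ _) ?_
    funext n hn
    refine (restOf_comp_app _ _ n hn).trans ((Eq.trans ?_ (restOf_comp_app _ _ n hn).symm))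
    change _ ≫ rst _ ≫ _ = _ ≫ rst _ ≫ _
    rw [← Category.assoc, rst_comm, Category.assoc]
  rst_rst_comp {X Y V} f g := by
    refine Hom.ext (rst_rst_comp _ _) ?_
    funext n hn
    refine Eq.trans ?_ (restOf_comp_app _ _ n hn).symm
    change rst (_ ≫ rst (Hom.base f) ≫ Hom.base g) ≫ _ = _ ≫ rst _ ≫ _
    rw [← Category.assoc (powLast _ _ _), comp_rst, Category.assoc, rst_rst_comp, Category.assoc]
  comp_rst {X Y V} f g := by
    refine Hom.ext (comp_rst _ _) ?_
    funext n hn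
    exact (comp_restOf_app _ _ n hn).trans (restOf_comp_app _ _ n hn).symm

end Faa

end

namespace Faa

variable {C : Type u} [Category.{v} C] [CartesianRestrictionCategory C] {X Y : Faa C}

/-! All three relations are equations built from restrictions `rst f ≫ g`, and two maps are equal
exactly when their bases and all their components are equal. The proposition therefore follows once
the composite with a restriction is known to be computed component by component: `(rst f ≫ g)_* =
rst f_* ≫ g_*` and `(rst f ≫ g)_n = rst f_n ≫ g_n`. For the base this is immediate from the
definitions. For the components it is `app_rst_comp`, which carries the proof.

The reason is a collapse of the Faà di Bruno sum. The components of `rst f` of order at least two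
are restricted zeros, so any partition with a block of at least two elements puts a restricted zero
into some argument of `g_k`. By additivity that summand is itself a restricted zero. All summands
have the same domain, so adding these zeros neither changes the value nor shrinks the domain, and
only the partition into singletons remains. There the first component of `rst f` is a restricted
projection, so the summand is `g_n` restricted to the domain of `π_n f_*`. This computation is
`restOf_comp_app`. Finally the axiom `rst f_n = rst (π_n f_*)` on maps turns that domain into the
domain of `f_n`.

Parts (ii) and (iii) are then obtained by rewriting both sides of the defining equations. Totality
compares `rst f` with an identity, so no composite is involved: `rst f` depends on `f` only through
`rst f_*`, and the value `rst f_* = 1` yields the identity sequence `(1, π_0, 0, 0, …)`. This is why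
(i) needs no condition on the higher components. -/

theorem hom_ext_iff (f g : X ⟶ Y) :
    f = g ↔ Hom.base f = Hom.base g ∧ ∀ (n : ℕ) (hn : 0 < n), Hom.app f n hn = Hom.app g n hn :=
  ⟨fun h => h ▸ ⟨rfl, fun _ _ => rfl⟩, fun h => Hom.ext h.1 (funext₂ h.2)⟩

theorem base_rst_comp {V : Faa C} (f : X ⟶ V) (g : X ⟶ Y) :
    Hom.base (rst f ≫ g) = rst (Hom.base f) ≫ Hom.base g := rfl

/-- The Faà di Bruno sum collapses to the partition into singletons, which leaves `g_n` restricted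
by `π_n f_*`. The domain of `f_n` is by definition that of `π_n f_*`, so the restriction can be
written with `f_n` alone. In this form each order `n` decouples from the base and from the other
orders, as the componentwise statements require. -/
theorem app_rst_comp {V : Faa C} (f : X ⟶ V) (g : X ⟶ Y) (n : ℕ) (hn : 0 < n) :
    Hom.app (rst f ≫ g) n hn = rst (Hom.app f n hn) ≫ Hom.app g n hn := by
  -- The map `rst f` is built from `f_*` only, so `f_n` has to be traded for `π_n f_*` before the
  -- collapsed formula applies.
  rw [Hom.rst_app f n hn]
  exact restOf_comp_app _ _ n hn

/-- The map `h` enters each component only through the restriction of `π_n h`, and a composite `π_n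
h` has the same domain as `π_n (rst h)`. Hence the whole sequence is determined by the domain of
`h`, which is what lets totality be read off from `rst f_*` rather than from `f_*`. -/
theorem restOf_rst {T : C} (h : X.pt ⟶ T) : restOf X (rst h) = restOf X h := by
  refine Hom.ext (rst_rst h) ?_
  funext n hn
  change rst (_ ≫ rst h) ≫ _ = rst (_ ≫ h) ≫ _
  rw [rst_comp_rst]

theorem isTotal_iff_base (f : X ⟶ Y) : IsTotal f ↔ IsTotal (Hom.base f) := by
  constructor
  -- The bases of `rst f` and of the identity are, by definition, `rst f_*` and `1`, so the base of
  -- the equation `rst f = 1` is already the claim.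
  · exact fun h => congrArg Hom.base h
  · intro h
    change rst (Hom.base f) = 𝟙 X.pt at h
    change restOf X (Hom.base f) = Hom.id X
    -- Replacing `f_*` by `rst f_*` makes the hypothesis `rst f_* = 1` applicable. What remains is
    -- the restriction sequence of `1`, which is the identity because the projections `π_n` are
    -- total.
    rw [← restOf_rst, h, id_eq_restOf]

theorem rLe_iff (f g : X ⟶ Y) :
    RLe f g ↔ RLe (Hom.base f) (Hom.base g) ∧
      ∀ (n : ℕ) (hn : 0 < n), RLe (Hom.app f n hn) (Hom.app g n hn) := by
  simp only [RLe, hom_ext_iff, base_rst_comp, app_rst_comp]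

/-- Both sides of `rst f ≫ g = rst g ≫ f` are composites with a restriction, so the componentwise
formula applies to each, with the roles of `f` and `g` exchanged. For the order only the left side
of the equation needs it. -/
theorem compat_iff (f g : X ⟶ Y) :
    Compat f g ↔ Compat (Hom.base f) (Hom.base g) ∧
      ∀ (n : ℕ) (hn : 0 < n), Compat (Hom.app f n hn) (Hom.app g n hn) := by
  simp only [Compat, hom_ext_iff, base_rst_comp, app_rst_comp]

end Faa

theorem mainTheorem11 {C : Type u} [Category.{v} C] [CartesianRestrictionCategory C]
    {X Y : Faa C} (f g : X ⟶ Y) :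
    (IsTotal f ↔ IsTotal (Faa.Hom.base f)) ∧
    (RLe f g ↔ RLe (Faa.Hom.base f) (Faa.Hom.base g) ∧
      ∀ (n : ℕ) (hn : 0 < n), RLe (Faa.Hom.app f n hn) (Faa.Hom.app g n hn)) ∧
    (Compat f g ↔ Compat (Faa.Hom.base f) (Faa.Hom.base g) ∧
      ∀ (n : ℕ) (hn : 0 < n), Compat (Faa.Hom.app f n hn) (Faa.Hom.app g n hn)) :=
  ⟨Faa.isTotal_iff_base f, Faa.rLe_iff f g, Faa.compat_iff f g⟩
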